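/- Let $G$ be a virtually nilpotent group (that is, $G$ has a nilpotent subgroup of finite index) and let $A\subseteq G$ be finite and non-empty. For an integer $h\ge 1$ write $A^h=\{a_1a_2\cdots a_h : a_i\in A\}$ for the set of products of exactly $h$ elements of $A$, and let $\Gamma=\langle A\rangle$ be the subgroup of $G$ generated by $A$. Assume that $A$ generates $\Gamma$ as a semigroup, i.e. $$\Gamma=\bigcup_{h\ge 1}A^h .$$ Then for every integer $r\ge 1$ there exist integers $l=l(A,r)\ge 1$ and $h_0\ge 1$ such that for every integer $h\ge h_0$ there is a set $X_h\subseteq\Gamma$ with $$|X_h|\le l\qquad\text{and}\qquad A^{rh}\subseteq X_hA^h .$$ In particular, $A$ is an asymptotic approximate group: for every integer $r\ge1$ there exist integers $l\ge1$ and $h_0\ge1$ such that for every $h\ge h_0$ there is a set $X_h\subseteq G$ with $|X_h|\le l$ and $A^{rh}\subseteq X_hA^h$. -/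

import Mathlib

open scoped Pointwise

/-- A non-empty set `A` semigroup-generates the subgroup `Γ = ⟨A⟩` if `Γ = ⋃_{h ≥ 1} A ^ h`, where
`A ^ h` is the pointwise power, the set of products of exactly `h` elements of `A`. -/
def SemigroupGenerates {G : Type*} [Group G] (A : Set G) : Prop :=
  A.Nonempty ∧ (Subgroup.closure A : Set G) = ⋃ h : ℕ, ⋃ _ : 1 ≤ h, A ^ h

/-- `A` is an asymptotic `(r, l)`-approximate group (used with `r, l ≥ 1`): for all large `h`, the
power `A ^ (r * h)` is covered by at most `l` left translates of `A ^ h`. -/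
def IsAsymptoticApproxGroupWith {G : Type*} [Group G] (r l : ℕ) (A : Set G) : Prop :=
  A.Nonempty ∧ ∃ h₀ : ℕ, 1 ≤ h₀ ∧ ∀ h : ℕ, h₀ ≤ h →
    ∃ X : Set G, X.encard ≤ (l : ℕ∞) ∧ A ^ (r * h) ⊆ X * A ^ h

/-- `A` is an asymptotic approximate group: for every `r ≥ 1` there is `l ≥ 1`, depending only on
`A` and `r`, such that `A` is an asymptotic `(r, l)`-approximate group. -/
def IsAsymptoticApproxGroup {G : Type*} [Group G] (A : Set G) : Prop :=
  ∀ r : ℕ, 1 ≤ r → ∃ l : ℕ, 1 ≤ l ∧ IsAsymptoticApproxGroupWith r l A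

/-! If `|A ^ (C * k)| ≤ L |A ^ k|` for all large `k`, Ruzsa covering puts `A ^ (r * h - s)` inside
`F * A ^ k * (A ^ k)⁻¹` with `|F| ≤ L`. As `A⁻¹ ⊆ A ^ M`, the last two factors lie in `A ^ ((M + 1)
* k)`; taking `h = (M + 1) * k + s` and restoring `A ^ s` gives the covering. The inequality follows
from growth bounded above and below by multiples of one power `n ^ D`
(`exists_growth_degree_of_isVirtuallyNilpotent`).

In a nilpotent group, a left-normed commutator of `w` generators is a letter of weight `w` and cost
`n⁻ʷ`, so a word of length `n` has cost 1. Collecting the letters one by one (`exists_collect`)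
keeps costs bounded and leaves `O(n ^ w)` possible exponents per letter. Conversely, powers up to `n
^ w` are reached, modulo later letters, by words of length `O(n)`
(`exists_mem_pow_congr_commutatorLayer`). A letter torsion modulo the later ones adds nothing to the
degree; any other adds `w` to both bounds. Schreier generators carry the result to the virtually
nilpotent case. -/

/-- `HasCost Λ ε K g` says that `g` is a product of letters `x` and inverse letters `x⁻¹`, where
`(x, v) ∈ Λ`, whose total cost is at most `K` if a letter of weight `v` costs `ε ^ v`. -/
inductive HasCost {G : Type*} [Group G] (Λ : List (G × ℕ)) (ε : ℝ) : ℝ → G → Prop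
  | one {K : ℝ} : 0 ≤ K → HasCost Λ ε K 1
  | mul {K : ℝ} {g x : G} {v : ℕ} :
      (x, v) ∈ Λ → HasCost Λ ε K g → HasCost Λ ε (K + ε ^ v) (x * g)
  | inv_mul {K : ℝ} {g x : G} {v : ℕ} :
      (x, v) ∈ Λ → HasCost Λ ε K g → HasCost Λ ε (K + ε ^ v) (x⁻¹ * g)

/-- The subgroup generated by the letters of weight at least `m`. -/
def letterSpan {G : Type*} [Group G] (Λ : List (G × ℕ)) (m : ℕ) : Subgroup G :=
  Subgroup.closure {y | ∃ v, m ≤ v ∧ (y, v) ∈ Λ}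

/-! ### Costs of words and the collection process -/

section Cost

variable {G : Type*} [Group G] {Λ : List (G × ℕ)} {ε : ℝ}

namespace HasCost

theorem mono {K K' : ℝ} {g : G} (h : HasCost Λ ε K g) (hK : K ≤ K') : HasCost Λ ε K' g := by
  induction h generalizing K' with
  | one h => exact .one (h.trans hK)
  | @mul K g x v hx _ ih =>
    have := HasCost.mul hx (ih (K' := K' - ε ^ v) (by linarith))
    rwa [sub_add_cancel] at this
  | @inv_mul K g x v hx _ ih =>
    have := HasCost.inv_mul hx (ih (K' := K' - ε ^ v) (by linarith))
    rwa [sub_add_cancel] at this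

theorem letter {x : G} {v : ℕ} (hx : (x, v) ∈ Λ) : HasCost Λ ε (ε ^ v) x := by
  simpa using HasCost.mul (ε := ε) hx (HasCost.one le_rfl)

theorem letter_inv {x : G} {v : ℕ} (hx : (x, v) ∈ Λ) : HasCost Λ ε (ε ^ v) x⁻¹ := by
  simpa using HasCost.inv_mul (ε := ε) hx (HasCost.one le_rfl)

theorem mul' {K L : ℝ} {g h : G} (hg : HasCost Λ ε K g) (hh : HasCost Λ ε L h) :
    HasCost Λ ε (K + L) (g * h) := by
  induction hg with
  | one h0 => simpa using hh.mono (by linarith)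
  | mul hx _ ih =>
    rw [mul_assoc]
    exact (HasCost.mul hx ih).mono (by linarith)
  | inv_mul hx _ ih =>
    rw [mul_assoc]
    exact (HasCost.inv_mul hx ih).mono (by linarith)

theorem inv {K : ℝ} {g : G} (hg : HasCost Λ ε K g) : HasCost Λ ε K g⁻¹ := by
  induction hg with
  | one h0 => simpa using HasCost.one h0
  | mul hx _ ih =>
    rw [mul_inv_rev]
    exact ih.mul' (letter_inv hx)
  | inv_mul hx _ ih =>
    rw [mul_inv_rev, inv_inv]
    exact ih.mul' (letter hx)

theorem pow {K : ℝ} {g : G} (hg : HasCost Λ ε K g) (n : ℕ) : HasCost Λ ε (n * K) (g ^ n) := by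
  induction n with
  | zero => simpa using HasCost.one le_rfl
  | succ n ih =>
    rw [pow_succ]
    exact (ih.mul' hg).mono (by push_cast; linarith)

theorem zpow {K : ℝ} {g : G} (hg : HasCost Λ ε K g) (n : ℤ) :
    HasCost Λ ε (|(n : ℝ)| * K) (g ^ n) := by
  obtain ⟨m, rfl | rfl⟩ := n.eq_nat_or_neg
  · simpa using hg.pow m
  · simpa using (hg.pow m).inv

end HasCost

/-- A word for `g` is fixed before `ε`, so its length serves as `K` at every scale. -/
theorem exists_hasCost_of_mem_letterSpan {m : ℕ} {g : G} (hg : g ∈ letterSpan Λ m) :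
    ∃ K : ℝ, 0 ≤ K ∧ ∀ ε : ℝ, 0 < ε → ε ≤ 1 → HasCost Λ ε (K * ε ^ m) g := by
  induction hg using Subgroup.closure_induction with
  | mem x hx =>
    obtain ⟨v, hv, hx⟩ := hx
    refine ⟨1, zero_le_one, fun ε h0 h1 => (HasCost.letter hx).mono ?_⟩
    rw [one_mul]
    exact pow_le_pow_of_le_one h0.le h1 hv
  | one => exact ⟨0, le_rfl, fun ε _ _ => .one (by simp)⟩
  | mul x y _ _ hx hy =>
    obtain ⟨K, hK, hx⟩ := hx
    obtain ⟨L, hL, hy⟩ := hy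
    refine ⟨K + L, by positivity, fun ε h0 h1 => ?_⟩
    rw [add_mul]
    exact (hx ε h0 h1).mul' (hy ε h0 h1)
  | inv x _ hx =>
    obtain ⟨K, hK, hx⟩ := hx
    exact ⟨K, hK, fun ε h0 h1 => (hx ε h0 h1).inv⟩

theorem List.exists_uniform_bound {α : Type*} {P : α → ℝ → Prop}
    (hP : ∀ a K L, K ≤ L → P a K → P a L) (l : List α) (h : ∀ a ∈ l, ∃ K, P a K) :
    ∃ K, 0 ≤ K ∧ ∀ a ∈ l, P a K := by
  induction l with
  | nil => exact ⟨0, le_rfl, by simp⟩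
  | cons b l ih =>
    obtain ⟨K, hK, hl⟩ := ih fun a ha => h a (List.mem_cons_of_mem _ ha)
    obtain ⟨L, hL⟩ := h b List.mem_cons_self
    refine ⟨max K L, le_max_of_le_left hK, fun a ha => ?_⟩
    rcases List.mem_cons.1 ha with rfl | ha
    · exact hP _ _ _ (le_max_right _ _) hL
    · exact hP _ _ _ (le_max_left _ _) (hl a ha)

/-- Conjugating a letter of weight `v` by at most `C ε⁻ʷ` copies of `c` multiplies its cost by a
bounded factor, if commutators with `c` raise weights by `w`. -/
theorem exists_hasCost_conj_pow {c : G} {w : ℕ} (hw : 1 ≤ w)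
    (hc : ∀ x v, (x, v) ∈ Λ → x⁻¹ * c⁻¹ * x * c ∈ letterSpan Λ (v + w)) {C : ℝ} :
    ∃ K, 0 ≤ K ∧ ∀ a ∈ Λ, ∀ ε : ℝ, 0 < ε → ε ≤ 1 → ∀ n : ℕ, n * ε ^ w ≤ C →
      HasCost Λ ε (K * ε ^ a.2) ((c ^ n)⁻¹ * a.1 * c ^ n) := by
  obtain ⟨M, -, hM⟩ : ∃ M : ℝ, 0 ≤ M ∧ ∀ a ∈ Λ, (a.2 : ℝ) ≤ M :=
    Λ.exists_uniform_bound (fun a K L h h' => h'.trans h) fun a _ => ⟨_, le_rfl⟩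
  obtain ⟨N, hN⟩ := exists_nat_ge M
  -- Descending induction on the weight: no letter is heavier than `N`, and the commutator of `x`
  -- with `c` involves only letters heavier than `x`.
  have key : ∀ d : ℕ, ∀ a ∈ Λ, N + 1 ≤ a.2 + d → ∃ K : ℝ, ∀ ε : ℝ, 0 < ε → ε ≤ 1 →
      ∀ n : ℕ, n * ε ^ w ≤ C → HasCost Λ ε (K * ε ^ a.2) ((c ^ n)⁻¹ * a.1 * c ^ n) := by
    intro d
    induction d with
    | zero =>
      intro a ha h
      have := (hM a ha).trans hN
      norm_cast at this
      omega
    | succ d ih =>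
      rintro ⟨x, v⟩ hx hd
      have hu : ∃ K : ℝ, 0 ≤ K ∧ ∀ ε : ℝ, 0 < ε → ε ≤ 1 → ∀ n : ℕ, n * ε ^ w ≤ C →
          HasCost Λ ε (K * ε ^ (v + w)) ((c ^ n)⁻¹ * (x⁻¹ * c⁻¹ * x * c) * c ^ n) := by
        refine Subgroup.closure_induction (p := fun u _ => ∃ K : ℝ, 0 ≤ K ∧ ∀ ε : ℝ, 0 < ε →
          ε ≤ 1 → ∀ n : ℕ, n * ε ^ w ≤ C →
          HasCost Λ ε (K * ε ^ (v + w)) ((c ^ n)⁻¹ * u * c ^ n)) ?_ ?_ ?_ ?_ (hc x v hx)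
        · rintro y ⟨u, hu, hy⟩
          obtain ⟨K, hK⟩ := ih (y, u) hy (by simp only at hd ⊢; omega)
          refine ⟨|K|, abs_nonneg K, fun ε h0 h1 n hn => (hK ε h0 h1 n hn).mono ?_⟩
          have : ε ^ u ≤ ε ^ (v + w) := pow_le_pow_of_le_one h0.le h1 hu
          calc K * ε ^ u ≤ |K| * ε ^ u := by gcongr; exact le_abs_self K
            _ ≤ _ := by gcongr
        · exact ⟨0, le_rfl, fun ε _ _ n _ => by simpa using HasCost.one le_rfl⟩
        · rintro y z - - ⟨K, hK0, hK⟩ ⟨L, hL0, hL⟩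
          refine ⟨K + L, by positivity, fun ε h0 h1 n hn => ?_⟩
          convert (hK ε h0 h1 n hn).mul' (hL ε h0 h1 n hn) using 1
          · ring
          · group
        · rintro y - ⟨K, hK0, hK⟩
          refine ⟨K, hK0, fun ε h0 h1 n hn => ?_⟩
          convert (hK ε h0 h1 n hn).inv using 1
          group
      obtain ⟨K, hK0, hK⟩ := hu
      refine ⟨1 + C * K, fun ε h0 h1 n hn => ?_⟩
      -- Each further conjugation by `c` appends one conjugated commutator of cost `K * ε ^ (v +
      -- w)`; with `n * ε ^ w ≤ C` these add at most `C * K * ε ^ v`.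
      have main : ∀ m : ℕ, m ≤ n →
          HasCost Λ ε (ε ^ v + m * (K * ε ^ (v + w))) ((c ^ m)⁻¹ * x * c ^ m) := by
        intro m
        induction m with
        | zero => intro _; simpa using HasCost.letter hx
        | succ m ihm =>
          intro hm
          have hm' : (m : ℝ) * ε ^ w ≤ C := by
            refine le_trans ?_ hn
            gcongr
            omega
          convert (ihm (by omega)).mul' (hK ε h0 h1 m hm') using 1
          · push_cast; ring
          · rw [pow_succ']; group
      refine (main n le_rfl).mono ?_
      have h2 : (n : ℝ) * (K * ε ^ (v + w)) = (n * ε ^ w) * (K * ε ^ v) := by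
        rw [pow_add]; ring
      have h3 : (n * ε ^ w) * (K * ε ^ v) ≤ C * (K * ε ^ v) := by gcongr
      rw [h2]
      simp only
      linarith
  refine Λ.exists_uniform_bound (P := fun a K => ∀ ε : ℝ, 0 < ε → ε ≤ 1 → ∀ n : ℕ,
    n * ε ^ w ≤ C → HasCost Λ ε (K * ε ^ a.2) ((c ^ n)⁻¹ * a.1 * c ^ n)) ?_
    fun a ha => key (N + 1) a ha (by omega)
  intro a K L hKL h ε h0 h1 n hn
  exact (h ε h0 h1 n hn).mono (by gcongr)

theorem exists_hasCost_conj_zpow {c : G} {w : ℕ} (hw : 1 ≤ w)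
    (hc : ∀ x v, (x, v) ∈ Λ → x⁻¹ * c⁻¹ * x * c ∈ letterSpan Λ (v + w))
    (hc' : ∀ x v, (x, v) ∈ Λ → x⁻¹ * c * x * c⁻¹ ∈ letterSpan Λ (v + w))
    {C : ℝ} :
    ∃ K, 0 ≤ K ∧ ∀ x v, (x, v) ∈ Λ → ∀ ε : ℝ, 0 < ε → ε ≤ 1 → ∀ p : ℤ, |(p : ℝ)| * ε ^ w ≤ C →
      HasCost Λ ε (K * ε ^ v) (c ^ (-p) * x * c ^ p) := by
  obtain ⟨K, hK0, hK⟩ := exists_hasCost_conj_pow (C := C) hw hc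
  obtain ⟨L, hL0, hL⟩ := exists_hasCost_conj_pow (c := c⁻¹) (C := C) hw
    (by simpa using hc')
  refine ⟨K + L, by positivity, fun x v hx ε h0 h1 p hp => ?_⟩
  have hv := pow_pos h0 v
  obtain ⟨m, rfl | rfl⟩ := p.eq_nat_or_neg
  · have := hK (x, v) hx ε h0 h1 m (by simpa using hp)
    simpa using this.mono (K' := (K + L) * ε ^ v) (by simp only; gcongr; linarith)
  · have := hL (x, v) hx ε h0 h1 m (by simpa using hp)
    simpa using this.mono (K' := (K + L) * ε ^ v) (by simp only; gcongr; linarith)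

/-- Collection: the letter `c` can be moved to the front at the expense of a bounded factor in the
cost of the remaining letters. -/
theorem exists_collect {c : G} {w : ℕ} (hw : 1 ≤ w)
    (hc : ∀ x v, (x, v) ∈ Λ → x⁻¹ * c⁻¹ * x * c ∈ letterSpan Λ (v + w))
    (hc' : ∀ x v, (x, v) ∈ Λ → x⁻¹ * c * x * c⁻¹ ∈ letterSpan Λ (v + w))
    {C : ℝ} :
    ∃ L, 0 ≤ L ∧ ∀ ε : ℝ, 0 < ε → ε ≤ 1 → ∀ K : ℝ, K ≤ C → ∀ g,
      HasCost ((c, w) :: Λ) ε K g →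
      ∃ p : ℤ, |(p : ℝ)| * ε ^ w ≤ K ∧ HasCost Λ ε (L * K) (c ^ (-p) * g) := by
  obtain ⟨L, hL0, hL⟩ := exists_hasCost_conj_zpow (C := C) hw hc hc'
  refine ⟨L, hL0, fun ε h0 h1 K hK g hg => ?_⟩
  induction hg with
  | one h => exact ⟨0, by simpa using h, by simpa using HasCost.one (by positivity)⟩
  | @mul K g x v hx hg ih =>
    have hv := pow_pos h0 v
    obtain ⟨p, hp, hpg⟩ := ih (by linarith)
    rcases List.mem_cons.1 hx with h | h
    · obtain ⟨rfl, rfl⟩ := Prod.mk.inj h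
      refine ⟨p + 1, ?_, ?_⟩
      · have : |((p + 1 : ℤ) : ℝ)| ≤ |(p : ℝ)| + 1 := by
          push_cast; simpa using abs_add_le (p : ℝ) 1
        calc _ ≤ (|(p : ℝ)| + 1) * ε ^ v := by gcongr
          _ ≤ _ := by linarith
      · convert hpg.mono (K' := L * (K + ε ^ v)) (by gcongr; linarith) using 1
        group
    -- Here `c ^ (-p) * (x * g) = (c ^ (-p) * x * c ^ p) * (c ^ (-p) * g)`.
    · refine ⟨p, by linarith, ?_⟩
      convert (hL x v h ε h0 h1 p (by linarith)).mul' hpg using 1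
      · ring
      · group
  | @inv_mul K g x v hx hg ih =>
    have hv := pow_pos h0 v
    obtain ⟨p, hp, hpg⟩ := ih (by linarith)
    rcases List.mem_cons.1 hx with h | h
    · obtain ⟨rfl, rfl⟩ := Prod.mk.inj h
      refine ⟨p - 1, ?_, ?_⟩
      · have : |((p - 1 : ℤ) : ℝ)| ≤ |(p : ℝ)| + 1 := by
          push_cast; simpa using abs_sub (p : ℝ) 1
        calc _ ≤ (|(p : ℝ)| + 1) * ε ^ v := by gcongr
          _ ≤ _ := by linarith
      · convert hpg.mono (K' := L * (K + ε ^ v)) (by gcongr; linarith) using 1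
        group
    · refine ⟨p, by linarith, ?_⟩
      convert (hL x v h ε h0 h1 p (by linarith)).inv.mul' hpg using 1
      · ring
      · group

end Cost

/-! ### Matching growth bounds for weighted systems -/

/-- A list of weighted letters in which every commutator of letters is spanned by letters of at
least the sum of the weights, and every `c ^ m` with `m ≤ n ^ w`, for `c` a letter of weight `w`,
agrees up to later letters with a product of `O(n)` elements of `S`. -/
def IsWeightedSystem {G : Type*} [Group G] (S : Set G) : List (G × ℕ) → Prop
  | [] => True
  | (c, w) :: Λ => 1 ≤ w ∧
      (∀ x v, (x, v) ∈ Λ → w ≤ v ∧ x⁻¹ * c⁻¹ * x * c ∈ letterSpan Λ (v + w) ∧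
        x⁻¹ * c * x * c⁻¹ ∈ letterSpan Λ (v + w)) ∧
      (∃ K : ℕ, ∀ n m : ℕ, 1 ≤ n → m ≤ n ^ w →
        ∃ e ∈ S ^ (K * n), (c ^ m)⁻¹ * e ∈ letterSpan Λ 0) ∧
      IsWeightedSystem S Λ

section Growth

variable {G : Type*} [Group G] {Λ : List (G × ℕ)}

theorem letterSpan_eq_of_le {w : ℕ} (h : ∀ x v, (x, v) ∈ Λ → w ≤ v) :
    letterSpan Λ 0 = letterSpan Λ w := by
  refine congrArg Subgroup.closure (Set.ext fun y => exists_congr fun v => ?_)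
  exact ⟨fun hy => ⟨h y v hy.2, hy.2⟩, fun hy => ⟨v.zero_le, hy.2⟩⟩

theorem letterSpan_mono {Λ' : List (G × ℕ)} (h : Λ ⊆ Λ') (m : ℕ) :
    letterSpan Λ m ≤ letterSpan Λ' m :=
  Subgroup.closure_mono fun _ ⟨v, hv, hy⟩ => ⟨v, hv, h hy⟩

theorem letterSpan_antitone : Antitone (letterSpan Λ) := fun _ _ h =>
  Subgroup.closure_mono fun _ ⟨v, hv, hy⟩ => ⟨v, h.trans hv, hy⟩

/-- The elements of bounded cost with respect to `Λ`, where letters of weight `v` cost `n⁻ᵛ`, are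
at most `O(n ^ D)` in number. -/
def CostGrowthLE {G : Type*} [Group G] (Λ : List (G × ℕ)) (D : ℕ) : Prop :=
  ∀ C : ℝ, ∃ K : ℕ, ∀ n : ℕ, 1 ≤ n → ∃ F : Finset G, F.card ≤ K * n ^ D ∧
    ∀ g, HasCost Λ (n : ℝ)⁻¹ C g → g ∈ F

/-- The span of `Λ` contains `n ^ D` products of `O(n)` elements of `S`. -/
def SpanGrowthGE {G : Type*} [Group G] (S : Set G) (Λ : List (G × ℕ)) (D : ℕ) : Prop :=
  ∃ K : ℕ, ∀ n : ℕ, 1 ≤ n → ∃ F : Finset G, (F : Set G) ⊆ S ^ (K * n) ∧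
    (F : Set G) ⊆ letterSpan Λ 0 ∧ n ^ D ≤ F.card

variable {c : G} {w D : ℕ} {S : Set G}

-- Only the residue of the exponent of `c` modulo `o` needs counting: the power of `c ^ o` is
-- absorbed into `Λ`.
open Classical in
theorem CostGrowthLE.cons_of_pow_mem (hw : 1 ≤ w)
    (hc : ∀ x v, (x, v) ∈ Λ → w ≤ v ∧ x⁻¹ * c⁻¹ * x * c ∈ letterSpan Λ (v + w) ∧
        x⁻¹ * c * x * c⁻¹ ∈ letterSpan Λ (v + w)) (hD : CostGrowthLE Λ D) {o : ℕ} (ho : 1 ≤ o)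
    (hco : c ^ o ∈ letterSpan Λ 0) : CostGrowthLE ((c, w) :: Λ) D := by
  intro C
  obtain ⟨L, hL0, hL⟩ := exists_collect (C := C) hw (fun x v h => (hc x v h).2.1)
    (fun x v h => (hc x v h).2.2)
  -- Weight at least `w` is what makes `(c ^ o) ^ (p / o)`, with `|p| ≤ C * n ^ w`, of bounded cost.
  rw [letterSpan_eq_of_le fun x v h => (hc x v h).1] at hco
  obtain ⟨M, hM0, hM⟩ := exists_hasCost_of_mem_letterSpan hco
  obtain ⟨K, hK⟩ := hD (C * M + L * C)
  refine ⟨o * K, fun n hn => ?_⟩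
  obtain ⟨F, hF, hFm⟩ := hK n hn
  have h0 : (0 : ℝ) < (n : ℝ)⁻¹ := by positivity
  have h1 : (n : ℝ)⁻¹ ≤ 1 := inv_le_one_of_one_le₀ (by exact_mod_cast hn)
  refine ⟨(Finset.range o ×ˢ F).image fun q => c ^ q.1 * q.2, ?_, fun g hg => ?_⟩
  · refine Finset.card_image_le.trans ?_
    rw [Finset.card_product, Finset.card_range, mul_assoc]
    gcongr
  · obtain ⟨p, hp, hpg⟩ := hL _ h0 h1 C le_rfl g hg
    have ho' : (0 : ℤ) < o := by exact_mod_cast ho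
    have hq : |((p / o : ℤ) : ℝ)| ≤ |(p : ℝ)| := by
      have : |p / (o : ℤ)| ≤ |p| := Int.abs_ediv_le_abs p o
      exact_mod_cast this
    have hpow := (hM _ h0 h1).zpow (p / o)
    have hcost : HasCost Λ (n : ℝ)⁻¹ (C * M + L * C) ((c ^ o) ^ (p / (o : ℤ)) * (c ^ (-p) * g)) := by
      refine (hpow.mul' hpg).mono ?_
      gcongr ?_ + _
      calc _ ≤ |(p : ℝ)| * (M * (n : ℝ)⁻¹ ^ w) := by gcongr
        _ = (|(p : ℝ)| * (n : ℝ)⁻¹ ^ w) * M := by ring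
        _ ≤ _ := by gcongr
    refine Finset.mem_image.2 ⟨((p % o).toNat, _), Finset.mem_product.2 ⟨?_, hFm _ hcost⟩, ?_⟩
    · have h2 := Int.emod_lt_of_pos p ho'
      have h3 := Int.emod_nonneg p ho'.ne'
      simp only [Finset.mem_range]
      omega
    · have h3 := Int.emod_nonneg p ho'.ne'
      simp only
      rw [← zpow_natCast c (p % o).toNat, Int.toNat_of_nonneg h3, ← zpow_natCast c o, ← zpow_mul,
        ← mul_assoc, ← mul_assoc, ← zpow_add, ← zpow_add, Int.emod_add_mul_ediv, add_neg_cancel,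
        zpow_zero, one_mul]

open Classical in
theorem CostGrowthLE.cons (hw : 1 ≤ w)
    (hc : ∀ x v, (x, v) ∈ Λ → w ≤ v ∧ x⁻¹ * c⁻¹ * x * c ∈ letterSpan Λ (v + w) ∧
        x⁻¹ * c * x * c⁻¹ ∈ letterSpan Λ (v + w)) (hD : CostGrowthLE Λ D) :
    CostGrowthLE ((c, w) :: Λ) (w + D) := by
  intro C
  obtain ⟨L, hL0, hL⟩ := exists_collect (C := C) hw (fun x v h => (hc x v h).2.1)
    (fun x v h => (hc x v h).2.2)
  obtain ⟨K, hK⟩ := hD (L * C)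
  obtain ⟨N, hN⟩ := exists_nat_ge C
  refine ⟨(2 * N + 1) * K, fun n hn => ?_⟩
  obtain ⟨F, hF, hFm⟩ := hK n hn
  have h0 : (0 : ℝ) < (n : ℝ)⁻¹ := by positivity
  have h1 : (n : ℝ)⁻¹ ≤ 1 := inv_le_one_of_one_le₀ (by exact_mod_cast hn)
  refine ⟨(Finset.Icc (-(N * n ^ w : ℕ) : ℤ) (N * n ^ w : ℕ) ×ˢ F).image
    fun q => c ^ q.1 * q.2, ?_, fun g hg => ?_⟩
  · refine Finset.card_image_le.trans ?_
    rw [Finset.card_product, Int.card_Icc]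
    have h2 : 1 ≤ n ^ w := Nat.one_le_pow _ _ hn
    have h3 : (((N * n ^ w : ℕ) : ℤ) + 1 - -((N * n ^ w : ℕ) : ℤ)).toNat ≤ (2 * N + 1) * n ^ w := by
      have : (2 * N + 1) * n ^ w = 2 * (N * n ^ w) + n ^ w := by ring
      omega
    calc _ ≤ ((2 * N + 1) * n ^ w) * (K * n ^ D) := by gcongr
      _ = _ := by ring
  · obtain ⟨p, hp, hpg⟩ := hL _ h0 h1 C le_rfl g hg
    refine Finset.mem_image.2 ⟨(p, _), Finset.mem_product.2 ⟨?_, hFm _ hpg⟩, ?_⟩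
    · have h2 : |(p : ℝ)| ≤ N * (n : ℝ) ^ w := by
        rw [inv_pow, ← div_eq_mul_inv, div_le_iff₀ (by positivity)] at hp
        exact hp.trans (by gcongr)
      have h3 : |p| ≤ ((N * n ^ w : ℕ) : ℤ) := by exact_mod_cast h2
      simpa [Finset.mem_Icc] using abs_le.1 h3
    · simp

open Classical in
theorem SpanGrowthGE.cons (hc : ∃ K : ℕ, ∀ n m : ℕ, 1 ≤ n → m ≤ n ^ w →
      ∃ e ∈ S ^ (K * n), (c ^ m)⁻¹ * e ∈ letterSpan Λ 0) (hD : SpanGrowthGE S Λ D)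
    (ho : ∀ o : ℕ, 1 ≤ o → c ^ o ∉ letterSpan Λ 0) :
    SpanGrowthGE S ((c, w) :: Λ) (w + D) := by
  obtain ⟨K, hK⟩ := hc
  obtain ⟨L, hL⟩ := hD
  refine ⟨K + L, fun n hn => ?_⟩
  obtain ⟨F, hFS, hFΛ, hF⟩ := hL n hn
  have he : ∀ m : ℕ, ∃ e, m ≤ n ^ w → e ∈ S ^ (K * n) ∧ (c ^ m)⁻¹ * e ∈ letterSpan Λ 0 := by
    intro m
    by_cases hm : m ≤ n ^ w
    · obtain ⟨e, he⟩ := hK n m hn hm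
      exact ⟨e, fun _ => he⟩
    · exact ⟨1, fun h => absurd h hm⟩
  choose e he using he
  have hle : letterSpan Λ 0 ≤ letterSpan ((c, w) :: Λ) 0 :=
    letterSpan_mono (List.subset_cons_self _ _) 0
  refine ⟨(Finset.range (n ^ w) ×ˢ F).image fun q => e q.1 * q.2, ?_, ?_, ?_⟩
  · intro g hg
    obtain ⟨⟨m, f⟩, hmf, rfl⟩ := Finset.mem_image.1 hg
    obtain ⟨hm, hf⟩ := Finset.mem_product.1 hmf
    rw [add_mul, pow_add]
    exact Set.mul_mem_mul (he m (Finset.mem_range.1 hm).le).1 (hFS hf)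
  · intro g hg
    obtain ⟨⟨m, f⟩, hmf, rfl⟩ := Finset.mem_image.1 hg
    obtain ⟨hm, hf⟩ := Finset.mem_product.1 hmf
    have hc0 : c ∈ letterSpan ((c, w) :: Λ) 0 :=
      Subgroup.subset_closure ⟨w, w.zero_le, List.mem_cons_self⟩
    have hcm : c ^ m ∈ letterSpan ((c, w) :: Λ) 0 := pow_mem hc0 m
    refine mul_mem ?_ (hle (hFΛ hf))
    simpa using mul_mem hcm (hle (he m (Finset.mem_range.1 hm).le).2)
  · rw [Finset.card_image_of_injOn, Finset.card_product, Finset.card_range, pow_add]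
    · gcongr
    -- A coincidence with `m' = m + d`, `d > 0`, would give `c ^ d ∈ letterSpan Λ 0`. The product is
    -- arranged so that normality of the span is not needed.
    have key : ∀ m m' : ℕ, m < n ^ w → m' < n ^ w → m ≤ m' → ∀ f ∈ F, ∀ f' ∈ F,
        e m * f = e m' * f' → m = m' := by
      intro m m' hm hm' hmm f hf f' hf' h
      obtain ⟨d, rfl⟩ := Nat.exists_eq_add_of_le hmm
      rcases Nat.eq_zero_or_pos d with rfl | hd
      · rfl
      refine absurd ?_ (ho d hd)
      have e1 := (he m hm.le).2
      have e2 := (he (m + d) hm'.le).2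
      have := mul_mem (mul_mem (mul_mem e1 (hFΛ hf)) (inv_mem (hFΛ hf'))) (inv_mem e2)
      convert this using 1
      have h4 : e m = e (m + d) * f' * f⁻¹ := by rw [← h]; group
      rw [h4, pow_add]
      group
    rintro ⟨m, f⟩ hmf ⟨m', f'⟩ hmf' h
    simp only [Finset.coe_product, Set.mem_prod, Finset.mem_coe, Finset.mem_range] at hmf hmf' h
    have hm : m = m' := by
      rcases le_total m m' with hmm | hmm
      · exact key m m' hmf.1 hmf'.1 hmm f hmf.2 f' hmf'.2 h
      · exact (key m' m hmf'.1 hmf.1 hmm f' hmf'.2 f hmf.2 h.symm).symm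
    subst hm
    simpa using h

/-- Both bounds get the same `D` because the same dichotomy, whether `c` is torsion modulo `Λ`,
decides the contribution of each letter. -/
theorem IsWeightedSystem.exists_growth (hΛ : IsWeightedSystem S Λ) :
    ∃ D, CostGrowthLE Λ D ∧ SpanGrowthGE S Λ D := by
  induction Λ with
  | nil =>
    refine ⟨0, fun C => ⟨1, fun n _ => ⟨{1}, by simp, fun g hg => ?_⟩⟩,
      ⟨0, fun n _ => ⟨{1}, by simp, by simp, by simp⟩⟩⟩
    cases hg with
    | one => simp
    | mul h => simp at h
    | inv_mul h => simp at h
  | cons a Λ ih =>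
    obtain ⟨c, w⟩ := a
    obtain ⟨hw, hc, he, hΛ⟩ := hΛ
    obtain ⟨D, hU, hL⟩ := ih hΛ
    by_cases ho : ∃ o : ℕ, 1 ≤ o ∧ c ^ o ∈ letterSpan Λ 0
    · obtain ⟨o, ho, hco⟩ := ho
      refine ⟨D, hU.cons_of_pow_mem hw hc ho hco, ?_⟩
      obtain ⟨K, hK⟩ := hL
      refine ⟨K, fun n hn => ?_⟩
      obtain ⟨F, h1, h2, h3⟩ := hK n hn
      exact ⟨F, h1, h2.trans (letterSpan_mono (List.subset_cons_self _ _) 0), h3⟩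
    · push Not at ho
      exact ⟨w + D, hU.cons hw hc, hL.cons he ho⟩

end Growth

theorem Set.Finite.pow_nat {M : Type*} [Monoid M] {A : Set M} (hA : A.Finite) (n : ℕ) :
    (A ^ n).Finite := by
  induction n with
  | zero => simp
  | succ n ih => rw [pow_succ]; exact ih.mul hA

/-! ### Commutators as a weighted system in a nilpotent group -/

section LowerCentralSeries

variable {G : Type*} [Group G]

open Subgroup
open scoped commutatorElement

/-- The three subgroups lemma relative to a normal subgroup. -/
theorem Subgroup.commutator_commutator_le_of_rotate {H₁ H₂ H₃ N : Subgroup G} [N.Normal]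
    (h1 : ⁅⁅H₂, H₃⁆, H₁⁆ ≤ N) (h2 : ⁅⁅H₃, H₁⁆, H₂⁆ ≤ N) : ⁅⁅H₁, H₂⁆, H₃⁆ ≤ N := by
  have key (H : Subgroup G) : H ≤ N ↔ H.map (QuotientGroup.mk' N) = ⊥ := by
    rw [Subgroup.map_eq_bot_iff, QuotientGroup.ker_mk']
  rw [key] at h1 h2 ⊢
  simp only [map_commutator] at h1 h2 ⊢
  exact commutator_commutator_eq_bot_of_rotate h1 h2

theorem Subgroup.commutator_lowerCentralSeries_le (a b : ℕ) :
    ⁅Subgroup.lowerCentralSeries (⊤ : Subgroup G) a, Subgroup.lowerCentralSeries (⊤ : Subgroup G) b⁆ ≤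
      Subgroup.lowerCentralSeries ⊤ (a + b + 1) := by
  induction b generalizing a with
  | zero => exact le_rfl
  | succ b ih =>
    rw [Subgroup.lowerCentralSeries_succ ⊤ b, commutator_comm]
    refine commutator_commutator_le_of_rotate ?_ ?_
    · rw [commutator_comm ⊤, ← Subgroup.lowerCentralSeries_succ]
      convert ih (a + 1) using 2
      ring
    · exact commutator_mono (ih a) le_rfl

theorem commutatorElement_mul_center_left {a b z : G} (hz : z ∈ center G) :
    ⁅a * z, b⁆ = ⁅a, b⁆ := by
  have h : Commute z b := (mem_center_iff.1 hz b).symm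
  rw [commutatorElement_mul_left_eq_conj_mul, h.commutator_eq]
  simp

theorem commutatorElement_pow_left {a b : G} (h : ⁅a, b⁆ ∈ center G) (q : ℕ) :
    ⁅a ^ q, b⁆ = ⁅a, b⁆ ^ q := by
  induction q with
  | zero => simp
  | succ q ih =>
    rw [pow_succ, commutatorElement_mul_left_eq_conj_mul, ih,
      mem_center_iff.1 h (a ^ q), mul_inv_cancel_right, pow_succ']

theorem commutatorElement_pow_pow {a b : G} (h : ⁅a, b⁆ ∈ center G) (q n : ℕ) :
    ⁅a ^ q, b ^ n⁆ = ⁅a, b⁆ ^ (q * n) := by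
  have h' : ⁅b, a⁆ ∈ center G := by
    rw [← commutatorElement_inv]
    exact inv_mem h
  have h2 : ⁅a, b ^ n⁆ = ⁅a, b⁆ ^ n := by
    rw [← commutatorElement_inv, commutatorElement_pow_left h', ← inv_pow, commutatorElement_inv]
  rw [commutatorElement_pow_left, h2, ← pow_mul, mul_comm n]
  rw [h2]
  exact pow_mem h n

/-- Left-normed commutators of `i + 1` elements of `S`. -/
def commutatorLayer (S : List G) : ℕ → List G
  | 0 => S
  | i + 1 => (commutatorLayer S i).flatMap fun c => S.map fun s => ⁅c, s⁆

theorem mem_commutatorLayer_succ {S : List G} {i : ℕ} {x : G} :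
    x ∈ commutatorLayer S (i + 1) ↔ ∃ c ∈ commutatorLayer S i, ∃ s ∈ S, ⁅c, s⁆ = x := by
  simp [commutatorLayer]

theorem commutatorLayer_subset (S : List G) {i : ℕ} {x : G} (hx : x ∈ commutatorLayer S i) :
    x ∈ Subgroup.lowerCentralSeries (⊤ : Subgroup G) i := by
  induction i generalizing x with
  | zero => exact mem_top x
  | succ i ih =>
    obtain ⟨c, hc, s, -, rfl⟩ := mem_commutatorLayer_succ.1 hx
    exact commutator_mem_commutator (ih hc) (mem_top s)

/-- Modulo the right-hand side `P` for `i + 1`, commutators from layer `i` commute with the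
generators, so term `i` of the series becomes central and its commutators with `G` fall in `P`. -/
theorem lowerCentralSeries_le_closure_sup {S : List G} (hS : closure {x | x ∈ S} = ⊤) (i : ℕ) :
    Subgroup.lowerCentralSeries (⊤ : Subgroup G) i ≤
      closure {x | x ∈ commutatorLayer S i} ⊔ Subgroup.lowerCentralSeries ⊤ (i + 1) := by
  induction i with
  | zero => simp [commutatorLayer, hS]
  | succ i ih =>
    set P := closure {x | x ∈ commutatorLayer S (i + 1)} ⊔ Subgroup.lowerCentralSeries ⊤ (i + 1 + 1)
      with hP
    have hPle : P ≤ Subgroup.lowerCentralSeries ⊤ (i + 1) :=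
      sup_le ((closure_le _).2 fun x hx => commutatorLayer_subset S hx)
        (Subgroup.lowerCentralSeries_antitone _ (Nat.le_succ _))
    have hPn : P.Normal := by
      rw [← commutator_top_right_le_iff]
      exact (commutator_mono hPle le_rfl).trans le_sup_right
    have hmk : ∀ x g : G, ⁅x, g⁆ ∈ P →
        Commute (QuotientGroup.mk' P x) (QuotientGroup.mk' P g) := by
      intro x g h
      rw [← commutatorElement_eq_one_iff_commute, ← map_commutatorElement]
      exact (QuotientGroup.eq_one_iff _).2 h
    have hcen : Subgroup.lowerCentralSeries (⊤ : Subgroup G) i ≤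
        (center (G ⧸ P)).comap (QuotientGroup.mk' P) := by
      refine ih.trans (sup_le ((closure_le _).2 fun c hc => ?_) fun x hx => ?_)
      · have htop : (⊤ : Subgroup G) ≤
            (centralizer {QuotientGroup.mk' P c}).comap (QuotientGroup.mk' P) := by
          rw [← hS, closure_le]
          intro s hs
          have : ⁅c, s⁆ ∈ P :=
            le_sup_left (a := closure {x | x ∈ commutatorLayer S (i + 1)})
              (subset_closure (mem_commutatorLayer_succ.2 ⟨c, hc, s, hs, rfl⟩))
          exact mem_centralizer_singleton_iff.2 (hmk c s this).symm.eq
        refine mem_center_iff.2 fun q => ?_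
        obtain ⟨g, rfl⟩ := QuotientGroup.mk'_surjective P q
        exact mem_centralizer_singleton_iff.1 (htop (mem_top g))
      · refine mem_center_iff.2 fun q => ?_
        obtain ⟨g, rfl⟩ := QuotientGroup.mk'_surjective P q
        refine (hmk x g ?_).symm.eq
        exact le_sup_right (a := closure {x | x ∈ commutatorLayer S (i + 1)})
          (commutator_mem_commutator hx (mem_top g))
    rw [Subgroup.lowerCentralSeries_succ, commutator_le]
    intro x hx g _
    rw [← QuotientGroup.eq_one_iff (N := P), ← QuotientGroup.mk'_apply, map_commutatorElement,
      commutatorElement_eq_one_iff_commute]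
    exact (mem_center_iff.1 (hcen hx) _).symm

theorem commutatorElement_mem_pow {S : Set G} (hinv : S⁻¹ = S) {k l : ℕ} {a b : G}
    (ha : a ∈ S ^ k) (hb : b ∈ S ^ l) : ⁅a, b⁆ ∈ S ^ (k + l + k + l) := by
  have hi : ∀ (m : ℕ) (x : G), x ∈ S ^ m → x⁻¹ ∈ S ^ m := by
    intro m x hx
    have := Set.inv_mem_inv.2 hx
    rwa [← inv_pow, hinv] at this
  rw [commutatorElement_def, pow_add, pow_add, pow_add]
  exact Set.mul_mem_mul (Set.mul_mem_mul (Set.mul_mem_mul ha hb) (hi _ _ ha)) (hi _ _ hb)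

/-- The `m`-th power, `m ≤ n ^ (i + 1)`, of a left-normed commutator of `i + 1` elements of `S`
is congruent to a product of `O(n)` elements of `S`. -/
theorem exists_mem_pow_congr_commutatorLayer {S : List G} (h1 : 1 ∈ S)
    (hinv : {x | x ∈ S}⁻¹ = {x | x ∈ S}) (i : ℕ) {c : G} (hc : c ∈ commutatorLayer S i) :
    ∃ K : ℕ, ∀ n m : ℕ, 1 ≤ n → m ≤ n ^ (i + 1) →
      ∃ e ∈ {x | x ∈ S} ^ (K * n), (c ^ m)⁻¹ * e ∈ Subgroup.lowerCentralSeries (⊤ : Subgroup G) (i + 1) := by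
  have hmono {k l : ℕ} (h : k ≤ l) : {x | x ∈ S} ^ k ⊆ {x | x ∈ S} ^ l :=
    Set.pow_subset_pow_right h1 h
  induction i generalizing c with
  | zero =>
    refine ⟨1, fun n m _ hm => ⟨c ^ m, hmono (by simpa using hm) (Set.pow_mem_pow hc), by simp⟩⟩
  | succ i ih =>
    obtain ⟨c, hc', s, hs, rfl⟩ := mem_commutatorLayer_succ.1 hc
    obtain ⟨K, hK⟩ := ih hc'
    refine ⟨4 * K + 4, fun n m hn hm => ?_⟩
    -- Write `m = n * (m / n) + m % n`. Modulo the next term, `⁅c, s⁆ ^ m` is `⁅c ^ (m / n), s ^ n⁆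
    -- * ⁅c, s ^ (m % n)⁆`, and `c ^ (m / n)`, `c` may be replaced by the short words `e`, `f`.
    have hq : m / n ≤ n ^ (i + 1) :=
      Nat.div_le_of_le_mul (hm.trans (pow_succ' n (i + 1)).le)
    obtain ⟨e, he, hec⟩ := hK n (m / n) hn hq
    obtain ⟨f, hf, hfc⟩ := hK 1 1 le_rfl (by simp)
    have hr : m % n < n := Nat.mod_lt _ hn
    refine ⟨⁅e, s ^ n⁆ * ⁅f, s ^ (m % n)⁆, ?_, ?_⟩
    · have m1 := commutatorElement_mem_pow hinv he (Set.pow_mem_pow (n := n) hs)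
      have m2 := commutatorElement_mem_pow hinv hf (Set.pow_mem_pow (n := m % n) hs)
      have := Set.mul_mem_mul m1 m2
      rw [← pow_add] at this
      refine hmono ?_ this
      have : K * 1 ≤ K * n := by gcongr
      have : (4 * K + 4) * n = 4 * (K * n) + 4 * n := by ring
      omega
    · set N := Subgroup.lowerCentralSeries (⊤ : Subgroup G) (i + 1 + 1) with hN
      let π := QuotientGroup.mk' N
      have hcen : ∀ x ∈ Subgroup.lowerCentralSeries (⊤ : Subgroup G) (i + 1), π x ∈ center (G ⧸ N) := by
        intro x hx
        refine mem_center_iff.2 fun q => ?_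
        obtain ⟨g, rfl⟩ := QuotientGroup.mk'_surjective N q
        have : Commute (π x) (π g) := by
          rw [← commutatorElement_eq_one_iff_commute, ← map_commutatorElement]
          exact (QuotientGroup.eq_one_iff _).2 (commutator_mem_commutator hx (mem_top g))
        exact this.symm.eq
      have hcs : ⁅π c, π s⁆ ∈ center (G ⧸ N) := by
        rw [← map_commutatorElement]
        exact hcen _ (commutatorLayer_subset S hc)
      have key : ∀ (x : G) (q k : ℕ), (c ^ q)⁻¹ * x ∈ Subgroup.lowerCentralSeries (⊤ : Subgroup G) (i + 1) →
          π ⁅x, s ^ k⁆ = π ⁅c, s⁆ ^ (q * k) := by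
        intro x q k hx
        have : π x = π c ^ q * π ((c ^ q)⁻¹ * x) := by simp
        rw [map_commutatorElement, this, commutatorElement_mul_center_left (hcen _ hx), map_pow,
          commutatorElement_pow_pow hcs, map_commutatorElement]
      have hπ : π ((⁅c, s⁆ ^ m)⁻¹ * (⁅e, s ^ n⁆ * ⁅f, s ^ (m % n)⁆)) = 1 := by
        rw [map_mul, map_mul, key e _ n hec, key f 1 (m % n) hfc, ← pow_add, one_mul,
          Nat.div_add_mod', map_inv, map_pow, inv_mul_cancel]
      exact (QuotientGroup.eq_one_iff _).1 hπ

/-- The left-normed commutators of `i + 1, …, i + k` elements of `S`, weighted by length. -/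
def commutatorLetters (S : List G) : ℕ → ℕ → List (G × ℕ)
  | _, 0 => []
  | i, k + 1 => (commutatorLayer S i).map (fun c => (c, i + 1)) ++ commutatorLetters S (i + 1) k

theorem mem_commutatorLetters {S : List G} {i k v : ℕ} {x : G} :
    (x, v) ∈ commutatorLetters S i k ↔
      ∃ j, i ≤ j ∧ j < i + k ∧ v = j + 1 ∧ x ∈ commutatorLayer S j := by
  induction k generalizing i with
  | zero =>
    simp only [commutatorLetters, List.not_mem_nil, false_iff]
    rintro ⟨j, h1, h2, -⟩
    omega
  | succ k ih =>
    simp only [commutatorLetters, List.mem_append, List.mem_map, Prod.mk.injEq, ih]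
    constructor
    · rintro (⟨c, hc, rfl, rfl⟩ | ⟨j, h1, h2, h3⟩)
      · exact ⟨i, le_rfl, by omega, rfl, hc⟩
      · exact ⟨j, by omega, by omega, h3⟩
    · rintro ⟨j, h1, h2, rfl, h4⟩
      rcases h1.eq_or_lt with rfl | h1
      · exact Or.inl ⟨x, h4, rfl, rfl⟩
      · exact Or.inr ⟨j, h1, by omega, rfl, h4⟩

variable {S : List G} {N : ℕ}

theorem lowerCentralSeries_le_letterSpan (hS : closure {x | x ∈ S} = ⊤)
    (hN : Subgroup.lowerCentralSeries (⊤ : Subgroup G) N = ⊥) {i k m : ℕ} (hik : i + k = N) (him : i ≤ m) :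
    Subgroup.lowerCentralSeries (⊤ : Subgroup G) m ≤ letterSpan (commutatorLetters S i k) (m + 1) := by
  induction hd : N - m generalizing m with
  | zero =>
    refine (Subgroup.lowerCentralSeries_antitone _ (show N ≤ m by omega)).trans ?_
    rw [hN]
    exact bot_le
  | succ d ih =>
    refine (lowerCentralSeries_le_closure_sup hS m).trans (sup_le ?_ ?_)
    · exact closure_mono fun x hx =>
        ⟨m + 1, le_rfl, mem_commutatorLetters.2 ⟨m, him, by omega, rfl, hx⟩⟩
    · exact (ih (m := m + 1) (by omega) (by omega)).trans (letterSpan_antitone (by omega))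

theorem isWeightedSystem_commutatorLetters (h1 : 1 ∈ S) (hinv : {x | x ∈ S}⁻¹ = {x | x ∈ S})
    (hS : closure {x | x ∈ S} = ⊤) (hN : Subgroup.lowerCentralSeries (⊤ : Subgroup G) N = ⊥) {i k : ℕ}
    (hik : i + k = N) : IsWeightedSystem {x | x ∈ S} (commutatorLetters S i k) := by
  induction k generalizing i with
  | zero => trivial
  | succ k ih =>
    -- Letters of one layer are removed singly, so the claim is needed for every sublist left over.
    have key : ∀ l : List G, l ⊆ commutatorLayer S i → IsWeightedSystem {x | x ∈ S}
        (l.map (fun c => (c, i + 1)) ++ commutatorLetters S (i + 1) k) := by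
      intro l
      induction l with
      | nil => exact fun _ => ih (by omega)
      | cons c l ihl =>
        intro hl
        have hc : c ∈ commutatorLayer S i := hl List.mem_cons_self
        have hl' : l ⊆ commutatorLayer S i := fun x hx => hl (List.mem_cons_of_mem _ hx)
        have hspan : ∀ m, i + 1 ≤ m → Subgroup.lowerCentralSeries (⊤ : Subgroup G) m ≤ letterSpan
            (l.map (fun c => (c, i + 1)) ++ commutatorLetters S (i + 1) k) (m + 1) := fun m hm =>
          (lowerCentralSeries_le_letterSpan hS hN (by omega) hm).trans
            (letterSpan_mono (List.subset_append_right _ _) _)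
        refine ⟨by omega, fun x v hx => ?_, ?_, ihl hl'⟩
        · obtain ⟨j, hj, rfl, hxj⟩ : ∃ j, i ≤ j ∧ v = j + 1 ∧ x ∈ commutatorLayer S j := by
            rcases List.mem_append.1 hx with hx | hx
            · obtain ⟨y, hy, hxy⟩ := List.mem_map.1 hx
              obtain ⟨rfl, rfl⟩ := Prod.mk.inj hxy
              exact ⟨i, le_rfl, rfl, hl' hy⟩
            · obtain ⟨j, hj, -, hv, hxj⟩ := mem_commutatorLetters.1 hx
              exact ⟨j, by omega, hv, hxj⟩
          have hx' := inv_mem (commutatorLayer_subset S hxj)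
          have hc' := commutatorLayer_subset S hc
          have hle := (commutator_lowerCentralSeries_le (G := G) j i).trans
            (hspan (j + i + 1) (by omega))
          have hji : j + 1 + (i + 1) = j + i + 1 + 1 := by ring
          rw [hji]
          refine ⟨by omega, ?_, ?_⟩
          · have := hle (commutator_mem_commutator hx' (inv_mem hc'))
            simpa [commutatorElement_def] using this
          · have := hle (commutator_mem_commutator hx' hc')
            simpa [commutatorElement_def] using this
        · obtain ⟨K, hK⟩ := exists_mem_pow_congr_commutatorLayer h1 hinv i hc
          refine ⟨K, fun n m hn hm => ?_⟩
          obtain ⟨e, he, hec⟩ := hK n m hn hm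
          exact ⟨e, he, letterSpan_antitone (Nat.zero_le _)
            (hspan (i + 1) le_rfl hec)⟩
    exact key _ (fun _ h => h)

/-- The growth of a finitely generated nilpotent group is bounded above and below by multiples of
the same power. -/
theorem Group.IsNilpotent.exists_growth_degree [hG : Group.IsNilpotent G] {T : Set G}
    (hT : T.Finite) (h1 : 1 ∈ T) (hinv : T⁻¹ = T) (hgen : closure T = ⊤) :
    ∃ D K : ℕ, ∀ n : ℕ, 1 ≤ n → (T ^ n).ncard ≤ K * n ^ D ∧ n ^ D ≤ (T ^ (K * n)).ncard := by
  obtain ⟨S, rfl⟩ : ∃ S : List G, {x | x ∈ S} = T := ⟨hT.toFinset.toList, by ext; simp⟩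
  obtain ⟨N, hN⟩ := Subgroup.nilpotent_iff_lowerCentralSeries.1 hG
  -- `N + 1` layers ensure that the generators themselves are letters even when `N = 0`.
  have hN' : Subgroup.lowerCentralSeries (⊤ : Subgroup G) (N + 1) = ⊥ :=
    le_bot_iff.1 ((Subgroup.lowerCentralSeries_antitone _ N.le_succ).trans hN.le)
  obtain ⟨D, hU, L, hL⟩ := (isWeightedSystem_commutatorLetters (i := 0) (k := N + 1) h1 hinv hgen
    hN' (by omega)).exists_growth
  obtain ⟨K, hK⟩ := hU 1
  refine ⟨D, max K L, fun n hn => ⟨?_, ?_⟩⟩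
  · obtain ⟨F, hF, hmem⟩ := hK n hn
    have hcost : ∀ k : ℕ, ∀ g ∈ {x | x ∈ S} ^ k,
        HasCost (commutatorLetters S 0 (N + 1)) (n : ℝ)⁻¹ (k * (n : ℝ)⁻¹) g := by
      intro k
      induction k with
      | zero =>
        intro g hg
        obtain rfl : g = 1 := by simpa using hg
        exact .one (by simp)
      | succ k ih =>
        intro g hg
        rw [pow_succ] at hg
        obtain ⟨a, ha, s, hs, rfl⟩ := hg
        have : (s, 1) ∈ commutatorLetters S 0 (N + 1) :=
          mem_commutatorLetters.2 ⟨0, le_rfl, by omega, rfl, hs⟩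
        convert (ih a ha).mul' (.letter this) using 1
        push_cast
        ring
    have hsub : {x | x ∈ S} ^ n ⊆ (F : Set G) := fun g hg =>
      hmem g ((hcost n g hg).mono (mul_inv_cancel₀ (by positivity)).le)
    calc _ ≤ (F : Set G).ncard := Set.ncard_le_ncard hsub F.finite_toSet
      _ ≤ K * n ^ D := by rwa [Set.ncard_coe_finset]
      _ ≤ _ := by gcongr; exact le_max_left _ _
  · obtain ⟨F, hF, -, hcard⟩ := hL n hn
    have hsub : (F : Set G) ⊆ {x | x ∈ S} ^ (max K L * n) :=
      hF.trans (Set.pow_subset_pow_right h1 (by gcongr; exact le_max_right _ _))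
    calc n ^ D ≤ (F : Set G).ncard := by rwa [Set.ncard_coe_finset]
      _ ≤ _ := Set.ncard_le_ncard hsub (Set.Finite.pow_nat hT _)

end LowerCentralSeries

/-! ### Virtually nilpotent groups, doubling and covering -/

section VirtuallyNilpotent

variable {G : Type*} [Group G]

theorem Set.Nonempty.ncard_pow_mono {A : Set G} (hne : A.Nonempty) (hA : A.Finite) :
    Monotone fun n : ℕ => (A ^ n).ncard := by
  classical
  obtain ⟨B, rfl⟩ := hA.exists_finset_coe
  intro m n hmn
  simp only [← Finset.coe_pow, Set.ncard_coe_finset]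
  exact (Finset.coe_nonempty.1 hne).card_pow_mono hmn

theorem Group.IsNilpotent.of_le {H N : Subgroup G} (hN : Group.IsNilpotent N) (h : H ≤ N) :
    Group.IsNilpotent H := by
  obtain ⟨n, hn⟩ := (Subgroup.isNilpotent_iff_lowerCentralSeries N).1 hN
  refine (Subgroup.isNilpotent_iff_lowerCentralSeries H).2 ⟨n, le_bot_iff.1 ?_⟩
  rw [← hn]
  exact Subgroup.lowerCentralSeries_mono n h

theorem exists_growth_degree_of_isNilpotent_closure {U : Set G} (hU : U.Finite) (h1 : 1 ∈ U)
    (hinv : U⁻¹ = U) (hnil : Group.IsNilpotent (Subgroup.closure U)) :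
    ∃ D K : ℕ, ∀ n : ℕ, 1 ≤ n → (U ^ n).ncard ≤ K * n ^ D ∧ n ^ D ≤ (U ^ (K * n)).ncard := by
  let T : Set (Subgroup.closure U) := Subtype.val ⁻¹' U
  have hTU : (Subgroup.closure U).subtype '' T = U := by
    ext x
    constructor
    · rintro ⟨y, hy, rfl⟩
      exact hy
    · exact fun hx => ⟨⟨x, Subgroup.subset_closure hx⟩, hx, rfl⟩
  have hcard (n : ℕ) : (U ^ n).ncard = (T ^ n).ncard := by
    rw [← Set.ncard_image_of_injective (T ^ n) (Subgroup.subtype_injective _), Set.image_pow, hTU]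
  have hTinv : T⁻¹ = T := by
    ext x
    change (x : G)⁻¹ ∈ U ↔ (x : G) ∈ U
    rw [← Set.mem_inv, hinv]
  obtain ⟨D, K, h⟩ := Group.IsNilpotent.exists_growth_degree (T := T)
    (hU.preimage Subtype.val_injective.injOn) h1 hTinv Subgroup.closure_closure_coe_preimage
  exact ⟨D, K, fun n hn => by simpa only [hcard] using h n hn⟩

/-- A finite set of coset representatives, taken inside a given subgroup. -/
theorem Subgroup.exists_finite_transversal (N Γ : Subgroup G) [N.FiniteIndex] :
    ∃ T : Set G, T.Finite ∧ 1 ∈ T ∧ T ⊆ Γ ∧ ∀ g ∈ Γ, ∃ t ∈ T, g * t⁻¹ ∈ N := by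
  have hfin : Finite (G ⧸ N) := inferInstance
  have h : ∀ q : G ⧸ N, ∃ t ∈ Γ, ∀ g ∈ Γ, (QuotientGroup.mk g : G ⧸ N) = q →
      (QuotientGroup.mk t : G ⧸ N) = q := by
    intro q
    by_cases hq : ∃ t ∈ Γ, (QuotientGroup.mk t : G ⧸ N) = q
    · obtain ⟨t, ht, rfl⟩ := hq
      exact ⟨t, ht, fun _ _ _ => rfl⟩
    · exact ⟨1, Γ.one_mem, fun g hg hgq => absurd ⟨g, hg, hgq⟩ hq⟩
  choose f hfΓ hf using h
  -- Inversion turns left coset representatives into right ones.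
  refine ⟨insert 1 (Set.range fun q => (f q)⁻¹), (Set.finite_range _).insert 1, by simp, ?_, ?_⟩
  · rintro x (rfl | ⟨q, rfl⟩)
    · exact Γ.one_mem
    · exact Γ.inv_mem (hfΓ q)
  · intro g hg
    refine ⟨_, Or.inr ⟨QuotientGroup.mk g⁻¹, rfl⟩, ?_⟩
    have := QuotientGroup.eq.1 (hf (QuotientGroup.mk g⁻¹) g⁻¹ (Γ.inv_mem hg) rfl).symm
    simpa using this

/-- If a finite set `A` generates its span as a semigroup, any finite subset of the span has its
powers absorbed by powers of `A`, up to a bounded factor. -/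
theorem exists_ncard_pow_le_of_subset {A U : Set G} (hA : A.Finite) (hne : A.Nonempty)
    {N : ℕ} (hN : 1 ≤ N) (h1 : 1 ∈ A ^ N) (hU : U.Finite) (hUA : ∀ u ∈ U, ∃ j, u ∈ A ^ j) :
    ∃ M : ℕ, ∀ n : ℕ, 1 ≤ n → (U ^ n).ncard ≤ N * (A ^ (M * n)).ncard := by
  choose! f hf using hUA
  obtain ⟨M, hM⟩ : ∃ M, ∀ u ∈ U, f u ≤ M := by
    obtain ⟨M, hM⟩ := (hU.image f).bddAbove
    exact ⟨M, fun u hu => hM ⟨u, hu, rfl⟩⟩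
  have hpow : ∀ n : ℕ, ∀ g ∈ U ^ n, ∃ j ≤ M * n, g ∈ A ^ j := by
    intro n
    induction n with
    | zero =>
      intro g hg
      exact ⟨0, by omega, by simpa using hg⟩
    | succ n ih =>
      intro g hg
      rw [pow_succ] at hg
      obtain ⟨a, ha, u, hu, rfl⟩ := hg
      obtain ⟨j, hj, haj⟩ := ih a ha
      refine ⟨j + f u, ?_, ?_⟩
      · have := hM u hu
        rw [mul_add]
        omega
      · rw [pow_add]
        exact Set.mul_mem_mul haj (hf u hu)
  have hshift : ∀ (j i : ℕ), A ^ j ⊆ A ^ (j + N * i) := by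
    intro j i x hx
    rw [pow_add, pow_mul]
    have h := Set.pow_mem_pow (n := i) h1
    rw [one_pow] at h
    simpa using Set.mul_mem_mul hx h
  refine ⟨M + N, fun n hn => ?_⟩
  -- Exact powers of `A` need not be nested, but `1 ∈ A ^ N` allows shifts by `N`, which move any
  -- exponent `j ≤ M * n` into a window of `N` consecutive ones.
  have hsub : U ^ n ⊆ ⋃ r ∈ Finset.range N, A ^ (M * n + 1 + r) := by
    intro g hg
    obtain ⟨j, hj, hgj⟩ := hpow n g hg
    have hd := Nat.div_add_mod (M * n + N - j) N
    have hm := Nat.mod_lt (M * n + N - j) hN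
    refine Set.mem_iUnion₂.2
      ⟨N - 1 - (M * n + N - j) % N, Finset.mem_range.2 (by omega), ?_⟩
    convert hshift j ((M * n + N - j) / N) hgj using 2
    omega
  have hfin : (⋃ r ∈ Finset.range N, A ^ (M * n + 1 + r)).Finite :=
    (Finset.finite_toSet _).biUnion fun r _ => hA.pow_nat _
  calc (U ^ n).ncard ≤ _ := Set.ncard_le_ncard hsub hfin
    _ ≤ ∑ r ∈ Finset.range N, (A ^ (M * n + 1 + r)).ncard := Finset.set_ncard_biUnion_le _ _
    _ ≤ ∑ r ∈ Finset.range N, (A ^ ((M + N) * n)).ncard := by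
        refine Finset.sum_le_sum fun r hr => hne.ncard_pow_mono hA ?_
        have := Finset.mem_range.1 hr
        have h2 : N * 1 ≤ N * n := by gcongr
        rw [add_mul]
        omega
    _ = _ := by simp

/-- Polynomial growth, with matching exponents, of a finite set generating a virtually nilpotent
group as a semigroup. -/
theorem exists_growth_degree_of_isVirtuallyNilpotent (hG : Group.IsVirtuallyNilpotent G)
    {A : Set G} (hA : A.Finite) (hne : A.Nonempty)
    (hgen : ∀ g ∈ Subgroup.closure A, ∃ j, 1 ≤ j ∧ g ∈ A ^ j) :
    ∃ D K : ℕ, 1 ≤ K ∧ ∀ n : ℕ, 1 ≤ n →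
      (A ^ n).ncard ≤ K * n ^ D ∧ n ^ D ≤ K * (A ^ (K * n)).ncard := by
  obtain ⟨N, hN, hNfin⟩ := hG
  obtain ⟨T, hT, hT1, hTΓ, hTN⟩ := N.exists_finite_transversal (Subgroup.closure A)
  -- Schreier generators: rewriting a word letter by letter gives `A ^ n ⊆ U ^ n * T`, with `U`
  -- inside the nilpotent subgroup.
  let V : Set G := (T * A * T⁻¹) ∩ N
  have hV : V.Finite := ((hT.mul hA).mul hT.inv).inter_of_left _
  let U : Set G := insert 1 (V ∪ V⁻¹)
  have hU : U.Finite := (hV.union hV.inv).insert 1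
  have hVΓ : V ⊆ Subgroup.closure A := by
    rintro _ ⟨⟨_, ⟨t, ht, a, ha, rfl⟩, s, hs, rfl⟩, -⟩
    have := (Subgroup.closure A).inv_mem (hTΓ hs)
    rw [inv_inv] at this
    exact mul_mem (mul_mem (hTΓ ht) (Subgroup.subset_closure ha)) this
  have hUΓ : U ⊆ Subgroup.closure A := by
    rintro u (rfl | hu | hu)
    · exact one_mem _
    · exact hVΓ hu
    · simpa using inv_mem (hVΓ hu)
  have hUN : U ⊆ N := by
    rintro u (rfl | hu | hu)
    · exact one_mem _
    · exact hu.2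
    · simpa using inv_mem (show u⁻¹ ∈ N from hu.2)
  have hUinv : U⁻¹ = U := by
    ext x
    change (x⁻¹ = 1 ∨ x⁻¹ ∈ V ∨ x⁻¹⁻¹ ∈ V) ↔ (x = 1 ∨ x ∈ V ∨ x⁻¹ ∈ V)
    rw [inv_inv, inv_eq_one, or_comm (a := x⁻¹ ∈ V)]
  obtain ⟨D, K, hK⟩ := exists_growth_degree_of_isNilpotent_closure hU (Set.mem_insert 1 _) hUinv
    (hN.of_le ((Subgroup.closure_le _).2 hUN))
  have hAU : ∀ n : ℕ, A ^ n ⊆ U ^ n * T := by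
    intro n
    induction n with
    | zero => simpa using hT1
    | succ n ih =>
      intro g hg
      rw [pow_succ] at hg
      obtain ⟨b, hb, a, ha, rfl⟩ := hg
      obtain ⟨u, hu, t, ht, rfl⟩ := ih hb
      obtain ⟨s, hs, hsN⟩ := hTN (t * a) (mul_mem (hTΓ ht) (Subgroup.subset_closure ha))
      have hv : t * a * s⁻¹ ∈ U :=
        Or.inr (Or.inl ⟨Set.mul_mem_mul (Set.mul_mem_mul ht ha) (Set.inv_mem_inv.2 hs), hsN⟩)
      refine ⟨u * (t * a * s⁻¹), ?_, s, hs, by simp [mul_assoc]⟩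
      rw [pow_succ]
      exact Set.mul_mem_mul hu hv
  obtain ⟨P, hP, hP1⟩ := hgen 1 (one_mem _)
  obtain ⟨M, hM⟩ := exists_ncard_pow_le_of_subset hA hne hP hP1 hU fun u hu =>
    (hgen u (hUΓ hu)).imp fun _ h => h.2
  refine ⟨D, K * T.ncard + P + M * K + 1, by omega, fun n hn => ⟨?_, ?_⟩⟩
  · calc (A ^ n).ncard ≤ (U ^ n * T).ncard :=
          Set.ncard_le_ncard (hAU n) ((hU.pow_nat n).mul hT)
      _ ≤ (U ^ n).ncard * T.ncard := Set.natCard_mul_le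
      _ ≤ (K * n ^ D) * T.ncard := by gcongr; exact (hK n hn).1
      _ = (K * T.ncard) * n ^ D := by ring
      _ ≤ _ := by gcongr; omega
  · rcases Nat.eq_zero_or_pos K with rfl | hKpos
    · have := (hK n hn).1
      have h2 : 0 < (U ^ n).ncard :=
        (Set.ncard_pos (hU.pow_nat n)).2 ((Set.insert_nonempty 1 _).pow)
      omega
    · calc n ^ D ≤ (U ^ (K * n)).ncard := (hK n hn).2
        _ ≤ P * (A ^ (M * (K * n))).ncard := hM _ (Nat.mul_pos hKpos hn)
        _ ≤ _ := by
          refine Nat.mul_le_mul (by omega) (hne.ncard_pow_mono hA ?_)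
          rw [← mul_assoc]
          exact Nat.mul_le_mul_right n (by omega)

/-- The lower bound is available only at multiples of `K`, so `k` is compared with `K * (k / K)`,
from which it differs by a factor at most 2. Using `C + 1` keeps the exponent positive when `C = 0`.
-/
theorem exists_ncard_pow_mul_le (hG : Group.IsVirtuallyNilpotent G)
    {A : Set G} (hA : A.Finite) (hne : A.Nonempty)
    (hgen : ∀ g ∈ Subgroup.closure A, ∃ j, 1 ≤ j ∧ g ∈ A ^ j) (C : ℕ) :
    ∃ L k₀ : ℕ, 1 ≤ k₀ ∧ ∀ k : ℕ, k₀ ≤ k → (A ^ (C * k)).ncard ≤ L * (A ^ k).ncard := by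
  obtain ⟨D, K, hK, h⟩ := exists_growth_degree_of_isVirtuallyNilpotent hG hA hne hgen
  refine ⟨K * ((C + 1) * (2 * K)) ^ D * K, K, hK, fun k hk => ?_⟩
  have hm : 1 ≤ k / K := (Nat.one_le_div_iff hK).2 hk
  have hkm : k ≤ 2 * K * (k / K) := by
    have h1 := Nat.div_add_mod k K
    have h2 := Nat.mod_lt k hK
    have h3 : K * 1 ≤ K * (k / K) := by gcongr
    have h4 : 2 * K * (k / K) = 2 * (K * (k / K)) := by ring
    omega
  calc (A ^ (C * k)).ncard ≤ (A ^ ((C + 1) * k)).ncard :=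
        hne.ncard_pow_mono hA (by gcongr; omega)
    _ ≤ K * ((C + 1) * k) ^ D := (h _ (Nat.mul_pos C.succ_pos (hK.trans hk))).1
    _ ≤ K * ((C + 1) * (2 * K * (k / K))) ^ D := by gcongr
    _ = K * ((C + 1) * (2 * K)) ^ D * (k / K) ^ D := by rw [← mul_assoc, mul_pow, mul_assoc]
    _ ≤ K * ((C + 1) * (2 * K)) ^ D * (K * (A ^ (K * (k / K))).ncard) := by
        gcongr
        exact (h _ hm).2
    _ ≤ K * ((C + 1) * (2 * K)) ^ D * (K * (A ^ k).ncard) :=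
        Nat.mul_le_mul_left _ (Nat.mul_le_mul_left _ (hne.ncard_pow_mono hA (Nat.mul_div_le k K)))
    _ = _ := by ring

theorem exists_inv_subset_pow {A : Set G} (hA : A.Finite)
    (hgen : ∀ g ∈ Subgroup.closure A, ∃ j, 1 ≤ j ∧ g ∈ A ^ j) : ∃ M : ℕ, A⁻¹ ⊆ A ^ M := by
  have h : ∀ a ∈ A, ∃ j, a⁻¹ ∈ A ^ j := fun a ha =>
    (hgen a⁻¹ (inv_mem (Subgroup.subset_closure ha))).imp fun _ h => h.2
  choose! m hm using h
  -- Since `1 ∈ A ^ (m a + 1)`, each `a⁻¹` can be padded to length `N - 1` for any common multiple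
  -- `N` of the `m a + 1`.
  set N := ∏ a ∈ hA.toFinset, (m a + 1) with hN
  have hpos : 0 < N := Finset.prod_pos fun a _ => Nat.succ_pos _
  refine ⟨N - 1, fun b hb => ?_⟩
  have hb' : b⁻¹ ∈ A := hb
  obtain ⟨k, hk⟩ : m b⁻¹ + 1 ∣ N := Finset.dvd_prod_of_mem _ (hA.mem_toFinset.2 hb')
  obtain ⟨k, rfl⟩ : ∃ i, k = i + 1 := Nat.exists_eq_add_one_of_ne_zero (by rintro rfl; omega)
  have h1 : (1 : G) ∈ A ^ (m b⁻¹ + 1) := by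
    rw [pow_succ]
    simpa using Set.mul_mem_mul (hm _ hb') hb'
  have h2 : N - 1 = m b⁻¹ + (m b⁻¹ + 1) * k := by
    rw [hk, mul_add]
    omega
  rw [h2, pow_add, pow_mul]
  have h3 := Set.pow_mem_pow (n := k) h1
  rw [one_pow] at h3
  simpa using Set.mul_mem_mul (hm _ hb') h3

theorem exists_covering_of_isVirtuallyNilpotent (hG : Group.IsVirtuallyNilpotent G)
    {A : Set G} (hA : A.Finite) (hne : A.Nonempty)
    (hgen : ∀ g ∈ Subgroup.closure A, ∃ j, 1 ≤ j ∧ g ∈ A ^ j) (r : ℕ) (hr : 1 ≤ r) :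
    ∃ l : ℕ, 1 ≤ l ∧ ∃ h₀ : ℕ, 1 ≤ h₀ ∧ ∀ h : ℕ, h₀ ≤ h →
      ∃ X : Set G, X ⊆ (Subgroup.closure A : Set G) ∧ X.encard ≤ (l : ℕ∞) ∧
        A ^ (r * h) ⊆ X * A ^ h := by
  obtain ⟨M, hM⟩ := exists_inv_subset_pow hA hgen
  obtain ⟨L, k₀, hk₀, hL⟩ :=
    -- The two terms `r * (M + 1)` bound the parts `(M + 1) * k` and `s` of `h`, each multiplied by
    -- `r`; the final 1 is for the extra factor `A ^ k` in Ruzsa's hypothesis.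
    exists_ncard_pow_mul_le hG hA hne hgen (r * (M + 1) + r * (M + 1) + 1)
  refine ⟨L + 1, by omega, (M + 1) * k₀, Nat.mul_pos M.succ_pos hk₀, fun h hh => ?_⟩
  set k := h / (M + 1) with hk
  set s := h % (M + 1) with hs
  have hks : (M + 1) * k + s = h := Nat.div_add_mod h (M + 1)
  have hsM : s < M + 1 := Nat.mod_lt _ M.succ_pos
  have hkk : k₀ ≤ k := (Nat.le_div_iff_mul_le M.succ_pos).2 (by rwa [mul_comm])
  -- The `s` factors left by the division are set aside, and restored on the right after covering.
  have hsr : s ≤ r * h := by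
    calc s ≤ 1 * h := by omega
      _ ≤ r * h := by gcongr
  have hle : r * h - s + k ≤ (r * (M + 1) + r * (M + 1) + 1) * k := by
    have h1 : r * s ≤ r * (M + 1) * k := by
      calc r * s ≤ r * (M + 1) := by gcongr
        _ ≤ r * (M + 1) * k := Nat.le_mul_of_pos_right _ (by omega)
    have h2 : r * h = r * (M + 1) * k + r * s := by rw [← hks]; ring
    rw [add_mul, add_mul, one_mul]
    omega
  have hcard : (Nat.card ↑(A ^ (r * h - s) * A ^ k) : ℝ) ≤ L * Nat.card ↑(A ^ k) := by
    rw [← pow_add]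
    have := (hne.ncard_pow_mono hA hle).trans (hL k hkk)
    exact_mod_cast this
  obtain ⟨F, hFA, hF, hcov, hFfin⟩ :=
    Set.ruzsa_covering_mul (hA.pow_nat _) (hA.pow_nat k) (hne.pow) hcard
  have hclos : ∀ n : ℕ, A ^ n ⊆ Subgroup.closure A := by
    intro n
    induction n with
    | zero => simp
    | succ n ih =>
      rintro _ ⟨x, hx, a, ha, rfl⟩
      exact mul_mem (ih hx) (Subgroup.subset_closure ha)
  refine ⟨F, hFA.trans (hclos _), ?_, ?_⟩
  · have hF' : F.ncard ≤ L := by exact_mod_cast hF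
    rw [← hFfin.cast_ncard_eq]
    exact_mod_cast hF'.trans (Nat.le_succ L)
  · have hdiv : A ^ k / A ^ k ⊆ A ^ ((M + 1) * k) := by
      rw [div_eq_mul_inv, ← inv_pow, add_mul, one_mul, add_comm, pow_add, pow_mul]
      exact Set.mul_subset_mul_left (Set.pow_subset_pow_left hM)
    calc A ^ (r * h) = A ^ (r * h - s) * A ^ s := by rw [← pow_add, Nat.sub_add_cancel hsr]
      _ ⊆ F * (A ^ k / A ^ k) * A ^ s := Set.mul_subset_mul_right hcov
      _ ⊆ F * A ^ ((M + 1) * k) * A ^ s :=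
          Set.mul_subset_mul_right (Set.mul_subset_mul_left hdiv)
      _ = F * A ^ h := by rw [mul_assoc, ← pow_add, hks]

end VirtuallyNilpotent

theorem mainTheorem2 {G : Type*} [Group G] (hG : Group.IsVirtuallyNilpotent G)
    (A : Set G) (hfin : A.Finite) (hne : A.Nonempty) (hgen : SemigroupGenerates A) :
    (∀ r : ℕ, 1 ≤ r → ∃ l : ℕ, 1 ≤ l ∧ ∃ h₀ : ℕ, 1 ≤ h₀ ∧ ∀ h : ℕ, h₀ ≤ h →
      ∃ X : Set G, X ⊆ (Subgroup.closure A : Set G) ∧ X.encard ≤ (l : ℕ∞) ∧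
        A ^ (r * h) ⊆ X * A ^ h) ∧
    IsAsymptoticApproxGroup A := by
  have hgen' : ∀ g ∈ Subgroup.closure A, ∃ j, 1 ≤ j ∧ g ∈ A ^ j := by
    intro g hg
    have hg' : g ∈ (Subgroup.closure A : Set G) := hg
    rw [hgen.2] at hg'
    obtain ⟨j, hj, hgj⟩ := Set.mem_iUnion₂.1 hg'
    exact ⟨j, hj, hgj⟩
  have key := exists_covering_of_isVirtuallyNilpotent hG hfin hne hgen'
  refine ⟨key, fun r hr => ?_⟩
  obtain ⟨l, hl, h₀, hh₀, h⟩ := key r hr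
  refine ⟨l, hl, hne, h₀, hh₀, fun n hn => ?_⟩
  obtain ⟨X, -, hX⟩ := h n hn
  exact ⟨X, hX⟩
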